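/- Notation. For $K\subseteq\mathbb R^n$ and $a\in\mathbb R^n$ let $h_K(a)=\sup\{\langle a,x\rangle : x\in K\}\in[-\infty,+\infty]$ be the support function of $K$ (so $h_\emptyset\equiv-\infty$), and put $\lfloor\pm\infty\rfloor=\pm\infty$. For $S\subseteq\mathbb Z^n$ let $$\mathrm{CC}(K,S)=\bigcap_{a\in S}\{x\in\mathbb R^n : \langle a,x\rangle\le\lfloor h_K(a)\rfloor\},\qquad \mathrm{CC}(K)=\mathrm{CC}(K,\mathbb Z^n);$$ $\mathrm{CC}(K)$ is the Chvátal–Gomory (CG) closure of $K$, and it is called finitely generated if $\mathrm{CC}(K)=\mathrm{CC}(K,S)$ for some finite $S\subseteq\mathbb Z^n$. For a unit vector $v\in\mathbb R^n$ let $F_v(K)=K\cap\{x : \langle v,x\rangle=h_K(v)\}$ be the face of $K$ exposed by $v$; it is a proper exposed face if $F_v(K)\ne K$. Let $\mathrm{aff}(A)$ be the affine hull of $A$ (with $\mathrm{aff}(\emptyset)=\emptyset$), let $\mathrm{aff}_I(A)=\mathrm{aff}(\mathrm{aff}(A)\cap\mathbb Z^n)$, and let $\mathrm{relbd}(K)$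 be the boundary of $K$ relative to $\mathrm{aff}(K)$. Proposition. Let $K\subseteq\mathbb R^n$ be a compact convex set such that $\mathrm{CC}(F_v(K))$ is finitely generated for every proper exposed face $F_v(K)$ of $K$. Then there is a finite set $S\subseteq\mathbb Z^n$ such that $$\mathrm{CC}(K,S)\subseteq K\cap\mathrm{aff}_I(K)\qquad\text{and}\qquad \mathrm{CC}(K,S)\cap\mathrm{relbd}(K)=\mathrm{CC}(K)\cap\mathrm{relbd}(K).$$ -/

import Mathlib

namespace CGClosure

/-- The integer vector `a ∈ ℤⁿ`, regarded as a point of Euclidean space `ℝⁿ`. -/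
noncomputable def intVec {n : ℕ} (a : Fin n → ℤ) : EuclideanSpace ℝ (Fin n) :=
  WithLp.toLp 2 (fun i => (a i : ℝ))

/-- The support function `h_K(a) = sup {⟨a, x⟩ : x ∈ K}`, with values in the extended reals:
it is `-∞` for empty `K`, and `+∞` where the supremum is not finite. -/
noncomputable def supportFun {n : ℕ} (K : Set (EuclideanSpace ℝ (Fin n)))
    (a : EuclideanSpace ℝ (Fin n)) : EReal :=
  ⨆ x ∈ K, ((inner ℝ a x : ℝ) : EReal)

/-- The floor of an extended real: the usual floor on `ℝ`, and `⌊±∞⌋ = ±∞`. -/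
noncomputable def erealFloor (t : EReal) : EReal :=
  EReal.rec (motive := fun _ => EReal) ⊥ (fun r => ((⌊r⌋ : ℝ) : EReal)) ⊤ t

/-- The Chvátal–Gomory closure with respect to a set `S` of integer vectors,
`CC(K, S) = ⋂_{a ∈ S} {x : ⟨a, x⟩ ≤ ⌊h_K(a)⌋}`. -/
def cgClosureWith {n : ℕ} (K : Set (EuclideanSpace ℝ (Fin n))) (S : Set (Fin n → ℤ)) :
    Set (EuclideanSpace ℝ (Fin n)) :=
  ⋂ a ∈ S, {x | ((inner ℝ (intVec a) x : ℝ) : EReal) ≤ erealFloor (supportFun K (intVec a))}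

/-- The Chvátal–Gomory closure `CC(K) = CC(K, ℤⁿ)`. -/
def cgClosure {n : ℕ} (K : Set (EuclideanSpace ℝ (Fin n))) : Set (EuclideanSpace ℝ (Fin n)) :=
  cgClosureWith K Set.univ

/-- `CC(K)` is finitely generated: finitely many integer vectors already define it. -/
def FinitelyGenerated {n : ℕ} (K : Set (EuclideanSpace ℝ (Fin n))) : Prop :=
  ∃ S : Set (Fin n → ℤ), S.Finite ∧ cgClosure K = cgClosureWith K S

/-- The supporting hyperplane `H_v(K) = {x : h_K(v) = ⟨v, x⟩}`. -/
def supportHyperplane {n : ℕ} (K : Set (EuclideanSpace ℝ (Fin n)))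
    (v : EuclideanSpace ℝ (Fin n)) : Set (EuclideanSpace ℝ (Fin n)) :=
  {x | supportFun K v = ((inner ℝ v x : ℝ) : EReal)}

/-- The face `F_v(K) = K ∩ H_v(K)` of `K` exposed by `v`. -/
def exposedFace {n : ℕ} (K : Set (EuclideanSpace ℝ (Fin n)))
    (v : EuclideanSpace ℝ (Fin n)) : Set (EuclideanSpace ℝ (Fin n)) :=
  K ∩ supportHyperplane K v

/-- `aff_I(A) = aff(aff(A) ∩ ℤⁿ)`, empty if `aff(A)` contains no integer point. -/
noncomputable def affI {n : ℕ} (A : Set (EuclideanSpace ℝ (Fin n))) :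
    AffineSubspace ℝ (EuclideanSpace ℝ (Fin n)) :=
  affineSpan ℝ ((affineSpan ℝ A : Set (EuclideanSpace ℝ (Fin n))) ∩ Set.range intVec)

end CGClosure

/-! Fix a direction v. Dirichlet approximation writes (v, h_K(v)) as a positive combination of
points of ℤⁿ × ℤ close to its large multiples (`exists_pos_combination_near_smul`). These points
give finitely many cuts implying ⟨v, x⟩ ≤ h_K(v); on the hyperplane of equality they force ⟨b, x⟩ =
m with (b, m) close to t(v, h_K(v)), t large (`exists_finite_cuts`). If a gives a cut of F_v(K),
then a + b gives a cut of K that restricts to it on the hyperplane, so a finite description of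
CC(F_v(K)) lifts to K (`exists_finite_lift`).

The cuts found for v serve all nearby u: a polyhedron has finitely many tight sets, so a maximizer
of u over it either stays below h_K(u) or lies on the hyperplane of v, hence in CC(F_v(K)) ⊆ K ∩
CC(K) (`exists_finite_eventually`). Compactness of the unit sphere in the direction space of aff(K)
leaves finitely many cuts. They contain the closure in K once it lies in aff(K), and settle each
relative boundary point through a supporting direction.

Confinement to aff_I(K) is separate (`exists_finite_subset_affI`): along integer vectors a nearly
orthogonal to aff(K), K has width below 1, so the cuts for a and -a make ⟨a, x⟩ an integer. -/

namespace CGClosure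

open Filter Topology

/-! ### Dirichlet approximation in a cocompact subgroup -/

section Approximation

variable {E : Type*} [NormedAddCommGroup E] [NormedSpace ℝ E] [FiniteDimensional ℝ E]

/-- Dirichlet approximation for a cocompact additive subgroup `L`: arbitrarily large multiples
of `v` are arbitrarily close to `L`. -/
theorem exists_mem_near_smul (L : AddSubgroup E) (hL : ∃ R : ℝ, ∀ x : E, ∃ a ∈ L, ‖x - a‖ ≤ R)
    (v : E) (T : ℝ) {ε : ℝ} (hε : 0 < ε) : ∃ t : ℝ, T < t ∧ ∃ a ∈ L, ‖a - t • v‖ < ε := by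
  have : ProperSpace E := FiniteDimensional.proper_real E
  obtain ⟨R, hR⟩ := hL
  choose r hrL hr using hR
  -- Multiples of v spaced by M differ by more than T; their remainders are bounded, so two of them
  -- are close.
  let M : ℝ := max T 0 + 1
  have hM0 : 0 < M := by positivity
  have hMT : T < M := (le_max_left T 0).trans_lt (lt_add_one _)
  let y : ℕ → E := fun k => ((k : ℝ) * M) • v - r (((k : ℝ) * M) • v)
  obtain ⟨z, -, φ, hφ, hlim⟩ := (isCompact_closedBall (0 : E) R).tendsto_subseq
    (x := y) (fun k => mem_closedBall_zero_iff.2 (hr _))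
  obtain ⟨N, hN⟩ := Metric.cauchySeq_iff'.1 hlim.cauchySeq ε hε
  have hlt : φ N < φ (N + 1) := hφ (Nat.lt_succ_self N)
  have h1 : (φ N : ℝ) + 1 ≤ φ (N + 1) := by exact_mod_cast hlt
  refine ⟨((φ (N + 1) : ℝ) - φ N) * M, ?_,
    r (((φ (N + 1) : ℝ) * M) • v) - r (((φ N : ℝ) * M) • v), L.sub_mem (hrL _) (hrL _), ?_⟩
  · nlinarith
  · have h2 := hN (N + 1) (Nat.le_succ N)
    rw [dist_comm, dist_eq_norm] at h2
    have h3 : r (((φ (N + 1) : ℝ) * M) • v) - r (((φ N : ℝ) * M) • v)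
        - (((φ (N + 1) : ℝ) - φ N) * M) • v = (y ∘ φ) N - (y ∘ φ) (N + 1) := by
      simp only [y, Function.comp_apply, sub_mul, sub_smul]
      abel
    rwa [h3]

/-- Dividing by t shrinks the error to δ / t, and a finite-dimensional subspace is closed. -/
theorem mem_submodule_of_near_smul (Y : Submodule ℝ E) (v : E) (δ : ℝ)
    (h : ∀ T : ℝ, ∃ t : ℝ, T < t ∧ ∃ a ∈ Y, ‖a - t • v‖ < δ) : v ∈ Y := by
  have hY : IsClosed (Y : Set E) := Y.closed_of_finiteDimensional
  rw [← SetLike.mem_coe, ← hY.closure_eq, Metric.mem_closure_iff]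
  intro ε hε
  obtain ⟨t, ht, a, ha, hat⟩ := h (max 0 (δ / ε))
  have ht0 : 0 < t := (le_max_left _ _).trans_lt ht
  have htδ : δ / ε < t := (le_max_right _ _).trans_lt ht
  refine ⟨t⁻¹ • a, Y.smul_mem _ ha, ?_⟩
  have h1 : v - t⁻¹ • a = -(t⁻¹ • (a - t • v)) := by
    rw [smul_sub, smul_smul, inv_mul_cancel₀ ht0.ne', one_smul]; abel
  rw [dist_eq_norm, h1, norm_neg, norm_smul, norm_inv, Real.norm_of_nonneg ht0.le,
    inv_mul_lt_iff₀ ht0]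
  rw [div_lt_iff₀ hε] at htδ
  linarith

/-- Every vector is a positive combination of elements of a cocompact additive subgroup that are
close to large multiples of the vector. -/
theorem exists_pos_combination_near_smul (L : AddSubgroup E)
    (hL : ∃ R : ℝ, ∀ x : E, ∃ a ∈ L, ‖x - a‖ ≤ R) (v : E) (T : ℝ) {δ : ℝ} (hδ : 0 < δ) :
    ∃ (q : ℕ) (a : Option (Fin q) → E) (t c : Option (Fin q) → ℝ),
      (∀ i, a i ∈ L ∧ T < t i ∧ ‖a i - t i • v‖ < δ ∧ 0 < c i) ∧ ∑ i, c i • a i = v := by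
  set N := Module.finrank ℝ E with hN
  let δ' : ℝ := δ / (2 * (N + 1))
  have hδ' : 0 < δ' := by positivity
  have hNδ : N * δ' ≤ δ / 2 := by
    have : (N + 1) * δ' = δ / 2 := by simp only [δ']; field_simp
    nlinarith
  let C : Set E := {a | a ∈ L ∧ ∃ t : ℝ, T < t ∧ ‖a - t • v‖ < δ'}
  obtain ⟨q, hqN, f, hfC, hfspan, hfind⟩ : ∃ q ≤ N, ∃ f : Fin q → E, (∀ i, f i ∈ C) ∧
      Submodule.span ℝ (Set.range f) = Submodule.span ℝ C ∧ LinearIndependent ℝ f :=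
    ⟨_, Submodule.finrank_le _, Submodule.exists_fun_fin_finrank_span_eq ℝ C⟩
  choose hfL s hsT hs using hfC
  have hvY : v ∈ Submodule.span ℝ C := by
    refine mem_submodule_of_near_smul _ v δ' fun T' => ?_
    obtain ⟨t, ht, a, haL, ha⟩ := exists_mem_near_smul L hL v (max T T') hδ'
    exact ⟨t, (le_max_right _ _).trans_lt ht, a,
      Submodule.subset_span ⟨haL, t, (le_max_left _ _).trans_lt ht, ha⟩, ha⟩
  have hker : LinearMap.ker (Fintype.linearCombination ℝ f) = ⊥ :=
    LinearMap.ker_eq_bot.2 (linearIndependent_iff_injective_fintypeLinearCombination.1 hfind)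
  obtain ⟨g, hg⟩ := LinearMap.exists_leftInverse_of_injective _ hker
  have hgc : Continuous g := g.continuous_of_finiteDimensional
  -- An error below η has all its coordinates d i in the basis f below 1.
  obtain ⟨η, hη, hgη⟩ := Metric.continuousAt_iff.1 (hgc.continuousAt (x := 0)) 1 one_pos
  obtain ⟨t, ht, a, haL, ha⟩ := exists_mem_near_smul L hL v (max 0 (max T (T + ∑ i, s i)))
    (lt_min hη (lt_min (half_pos hδ) hδ'))
  simp only [lt_min_iff] at ha
  simp only [max_lt_iff] at ht
  obtain ⟨ht0, htT, htS⟩ := ht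
  have haC : a ∈ Submodule.span ℝ C := Submodule.subset_span ⟨haL, t, htT, ha.2.2⟩
  have heY : a - t • v ∈ Submodule.span ℝ (Set.range f) := by
    rw [hfspan]; exact Submodule.sub_mem _ haC (Submodule.smul_mem _ _ hvY)
  obtain ⟨d, hd⟩ := (Submodule.mem_span_range_iff_exists_fun ℝ).1 heY
  have hgd : g (a - t • v) = d := by
    have := LinearMap.congr_fun hg d
    simpa [Fintype.linearCombination_apply, hd] using this
  have hd1 : ∀ i, d i < 1 := by
    intro i
    have h1 := hgη (x := a - t • v) (by simpa using ha.1)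
    rw [map_zero, dist_zero_right, hgd] at h1
    exact (le_abs_self _).trans_lt ((norm_le_pi_norm d i).trans_lt h1)
  -- Since a - t • v = ∑ d i • f i, one has t • v = (a - ∑ f i) + ∑ (1 - d i) • f i, with positive
  -- weights. The error of the first term is below δ / 2 + N * δ' ≤ δ.
  refine ⟨q, fun i => i.elim (a - ∑ i, f i) f, fun i => i.elim (t - ∑ i, s i) s,
    fun i => i.elim t⁻¹ (fun i => t⁻¹ * (1 - d i)), ?_, ?_⟩
  · rintro (_ | i)
    · refine ⟨L.sub_mem haL (L.sum_mem fun i _ => hfL i), ?_, ?_, inv_pos.2 ht0⟩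
      · simp only [Option.elim]; linarith
      · have h1 : a - ∑ i, f i - (t - ∑ i, s i) • v
            = (a - t • v) - ∑ i, (f i - s i • v) := by
          rw [Finset.sum_sub_distrib, sub_smul, Finset.sum_smul]; abel
        have h2 : ‖∑ i, (f i - s i • v)‖ ≤ q * δ' := by
          refine (norm_sum_le _ _).trans ?_
          refine (Finset.sum_le_sum fun i _ => (hs i).le).trans ?_
          simp
        have h3 : (q : ℝ) * δ' ≤ N * δ' := by gcongr
        simp only [Option.elim]
        rw [h1]
        refine (norm_sub_le _ _).trans_lt ?_
        linarith [ha.2.1]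
    · refine ⟨hfL i, hsT i, (hs i).trans_le ?_, mul_pos (inv_pos.2 ht0) (by linarith [hd1 i])⟩
      have : (0 : ℝ) ≤ N := Nat.cast_nonneg _
      rw [div_le_iff₀ (by positivity)]
      nlinarith
  · rw [Fintype.sum_option]
    simp only [Option.elim, mul_smul, ← Finset.smul_sum, ← smul_add, sub_smul, one_smul,
      Finset.sum_sub_distrib]
    rw [hd]
    have : a - ∑ i, f i + (∑ i, f i - (a - t • v)) = t • v := by abel
    rw [this, smul_smul, inv_mul_cancel₀ ht0.ne', one_smul]

end Approximation

/-! ### Integer vectors and Chvátal–Gomory cuts of a compact set -/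

open scoped RealInnerProductSpace

variable {n : ℕ}

local notation "𝔼" n => EuclideanSpace ℝ (Fin n)

/-- `intVec` as an additive homomorphism. -/
noncomputable def intVecHom (n : ℕ) : (Fin n → ℤ) →+ 𝔼 n where
  toFun := intVec
  map_zero' := by ext i; simp [intVec]
  map_add' a b := by ext i; simp [intVec]

theorem intVec_add (a b : Fin n → ℤ) : intVec (a + b) = intVec a + intVec b :=
  (intVecHom n).map_add a b

theorem intVec_sub (a b : Fin n → ℤ) : intVec (a - b) = intVec a - intVec b :=
  (intVecHom n).map_sub a b

theorem intVec_neg (a : Fin n → ℤ) : intVec (-a) = -intVec a :=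
  (intVecHom n).map_neg a

theorem intVec_zsmul (k : ℤ) (a : Fin n → ℤ) : intVec (k • a) = (k : ℝ) • intVec a := by
  ext i; simp [intVec]

theorem inner_intVec (a : Fin n → ℤ) (x : 𝔼 n) : ⟪intVec a, x⟫ = ∑ i, (a i : ℝ) * x i := by
  simp [intVec, PiLp.inner_apply, mul_comm]

theorem intVec_cocompact (n : ℕ) :
    ∃ R : ℝ, ∀ x : 𝔼 n, ∃ a ∈ (intVecHom n).range, ‖x - a‖ ≤ R := by
  refine ⟨√n, fun x => ⟨intVec fun i => ⌊x i⌋, ⟨fun i => ⌊x i⌋, rfl⟩, ?_⟩⟩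
  rw [EuclideanSpace.norm_eq]
  refine Real.sqrt_le_sqrt ?_
  calc ∑ i, ‖(x - intVec fun i => ⌊x i⌋) i‖ ^ 2 ≤ ∑ _i : Fin n, (1 : ℝ) := by
        refine Finset.sum_le_sum fun i _ => ?_
        have h0 := Int.fract_nonneg (x i)
        have h1 := (Int.fract_lt_one (x i)).le
        have h2 : (x - intVec fun i => ⌊x i⌋) i = Int.fract (x i) := Int.self_sub_floor (x i)
        rw [h2, Real.norm_of_nonneg h0]
        exact pow_le_one₀ h0 h1
    _ = n := by simp

theorem intVec_prod_cocompact (n : ℕ) :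
    ∃ R : ℝ, ∀ x : (𝔼 n) × ℝ,
      ∃ a ∈ ((intVecHom n).prodMap (Int.castAddHom ℝ)).range, ‖x - a‖ ≤ R := by
  obtain ⟨R, hR⟩ := intVec_cocompact n
  refine ⟨max R 1, fun x => ?_⟩
  obtain ⟨_, ⟨a, rfl⟩, ha⟩ := hR x.1
  refine ⟨(intVecHom n a, (⌊x.2⌋ : ℝ)), ⟨(a, ⌊x.2⌋), rfl⟩, max_le_max ha ?_⟩
  have h2 : x.2 - (⌊x.2⌋ : ℝ) = Int.fract x.2 := rfl
  simp only [Prod.snd_sub, h2, Real.norm_of_nonneg (Int.fract_nonneg x.2)]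
  exact (Int.fract_lt_one x.2).le

theorem erealFloor_coe (r : ℝ) : erealFloor (r : EReal) = ((⌊r⌋ : ℝ) : EReal) := rfl

theorem supportFun_eq_of_forall_le {K : Set (𝔼 n)} {a p : 𝔼 n} (hp : p ∈ K)
    (hmax : ∀ y ∈ K, ⟪a, y⟫ ≤ ⟪a, p⟫) : supportFun K a = ((⟪a, p⟫ : ℝ) : EReal) :=
  le_antisymm (iSup₂_le fun y hy => EReal.coe_le_coe_iff.2 (hmax y hy))
    (le_iSup₂ (f := fun x (_ : x ∈ K) => ((⟪a, x⟫ : ℝ) : EReal)) p hp)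

theorem exists_forall_inner_le {K : Set (𝔼 n)} (hK : IsCompact K) (hne : K.Nonempty) (a : 𝔼 n) :
    ∃ p ∈ K, ∀ y ∈ K, ⟪a, y⟫ ≤ ⟪a, p⟫ := by
  obtain ⟨p, hp, hmax⟩ := hK.exists_isMaxOn (f := fun x => ⟪a, x⟫) hne (by fun_prop)
  exact ⟨p, hp, fun y hy => hmax hy⟩

theorem mem_supportHyperplane_iff {K : Set (𝔼 n)} {v p x : 𝔼 n} (hp : p ∈ K)
    (hmax : ∀ y ∈ K, ⟪v, y⟫ ≤ ⟪v, p⟫) : x ∈ supportHyperplane K v ↔ ⟪v, x⟫ = ⟪v, p⟫ := by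
  rw [supportHyperplane, Set.mem_ofPred_eq, supportFun_eq_of_forall_le hp hmax,
    EReal.coe_eq_coe_iff, eq_comm]

theorem mem_cgClosureWith_iff {K : Set (𝔼 n)} (hK : IsCompact K) (hne : K.Nonempty)
    {S : Set (Fin n → ℤ)} {x : 𝔼 n} : x ∈ cgClosureWith K S ↔
      ∀ a ∈ S, ∃ p ∈ K, (∀ y ∈ K, ⟪intVec a, y⟫ ≤ ⟪intVec a, p⟫) ∧
        ⟪intVec a, x⟫ ≤ ⌊⟪intVec a, p⟫⌋ := by
  simp only [cgClosureWith, Set.mem_iInter, Set.mem_ofPred_eq]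
  refine forall₂_congr fun a _ => ⟨fun h => ?_, fun ⟨p, hp, hmax, h⟩ => ?_⟩
  · obtain ⟨p, hp, hmax⟩ := exists_forall_inner_le hK hne (intVec a)
    rw [supportFun_eq_of_forall_le hp hmax, erealFloor_coe, EReal.coe_le_coe_iff] at h
    exact ⟨p, hp, hmax, h⟩
  · rwa [supportFun_eq_of_forall_le hp hmax, erealFloor_coe, EReal.coe_le_coe_iff]

theorem cgClosureWith_anti {K : Set (𝔼 n)} {S T : Set (Fin n → ℤ)} (h : S ⊆ T) :
    cgClosureWith K T ⊆ cgClosureWith K S :=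
  Set.biInter_subset_biInter_left h

theorem cgClosure_subset {K : Set (𝔼 n)} (S : Set (Fin n → ℤ)) :
    cgClosure K ⊆ cgClosureWith K S :=
  cgClosureWith_anti (Set.subset_univ S)

/-- By compactness the support function is attained, so it is below m + 1 and its floor is at most
m. -/
theorem inner_le_of_mem_cgClosureWith {K : Set (𝔼 n)} (hK : IsCompact K) (hne : K.Nonempty)
    {S : Set (Fin n → ℤ)} {x : 𝔼 n} (hx : x ∈ cgClosureWith K S) {a : Fin n → ℤ} (ha : a ∈ S)
    {m : ℤ} (h : ∀ y ∈ K, ⟪intVec a, y⟫ < m + 1) : ⟪intVec a, x⟫ ≤ m := by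
  obtain ⟨p, hp, -, hx⟩ := (mem_cgClosureWith_iff hK hne).1 hx a ha
  refine hx.trans ?_
  exact_mod_cast Int.lt_add_one_iff.1 (Int.floor_lt.2 (by exact_mod_cast h p hp))

theorem cgClosure_mono {F K : Set (𝔼 n)} (hF : IsCompact F) (hFne : F.Nonempty)
    (hK : IsCompact K) (h : F ⊆ K) : cgClosure F ⊆ cgClosure K := by
  intro x hx
  refine (mem_cgClosureWith_iff hK (hFne.mono h)).2 fun a _ => ?_
  obtain ⟨p, hp, hmax⟩ := exists_forall_inner_le hK (hFne.mono h) (intVec a)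
  refine ⟨p, hp, hmax, inner_le_of_mem_cgClosureWith hF hFne hx (Set.mem_univ a) fun y hy => ?_⟩
  exact (hmax y (h hy)).trans_lt (Int.lt_floor_add_one _)

theorem abs_inner_le_of_norm_le {e y : 𝔼 n} {δ R : ℝ} (he : ‖e‖ ≤ δ) (hy : ‖y‖ ≤ R) :
    |⟪e, y⟫| ≤ δ * R :=
  (abs_real_inner_le_norm e y).trans
    (mul_le_mul he hy (norm_nonneg _) ((norm_nonneg _).trans he))

/-- Finitely many Chvátal–Gomory cuts imply a given valid inequality, and on its hyperplane they
force an integral equation whose normal is close to a large multiple of the given normal. -/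
theorem exists_finite_cuts {K : Set (𝔼 n)} (hK : IsCompact K) {v p : 𝔼 n} (hp : p ∈ K)
    (hmax : ∀ y ∈ K, ⟪v, y⟫ ≤ ⟪v, p⟫) (T : ℝ) {δ : ℝ} (hδ : 0 < δ) :
    ∃ S : Set (Fin n → ℤ), S.Finite ∧ (∀ x ∈ cgClosureWith K S, ⟪v, x⟫ ≤ ⟪v, p⟫) ∧
      ∃ (b : Fin n → ℤ) (m : ℤ) (t : ℝ), T < t ∧ ‖intVec b - t • v‖ < δ ∧
        |m - t * ⟪v, p⟫| < δ ∧
        ∀ x ∈ cgClosureWith K S, ⟪v, x⟫ = ⟪v, p⟫ → ⟪intVec b, x⟫ = m := by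
  obtain ⟨R, hR0, hR⟩ := hK.isBounded.exists_pos_norm_le
  -- An error ε in normal and right-hand side shifts the inequality by at most ε(1 + R) on K. The
  -- bound 1 / (1 + R) keeps this within 1, so rounding down yields the right-hand side m.
  have hδ' : 0 < min δ (1 / (1 + R)) := lt_min hδ (by positivity)
  obtain ⟨q, A, t, c, hA, hsum⟩ := exists_pos_combination_near_smul _ (intVec_prod_cocompact n)
    (v, ⟪v, p⟫) (max T 0) hδ'
  have hA1 := fun i => (hA i).1
  choose B hB using hA1
  have hBA : ∀ i, A i = (intVec (B i).1, ((B i).2 : ℝ)) := fun i => (hB i).symm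
  have hTt : ∀ i, T < t i := fun i => (le_max_left _ _).trans_lt (hA i).2.1
  have ht0 : ∀ i, 0 < t i := fun i => (le_max_right _ _).trans_lt (hA i).2.1
  have hc : ∀ i, 0 < c i := fun i => (hA i).2.2.2
  have hnear : ∀ i, ‖intVec (B i).1 - t i • v‖ < min δ (1 / (1 + R)) := fun i => by
    have := (hA i).2.2.1
    rw [hBA] at this
    exact (norm_fst_le _).trans_lt this
  have hnear' : ∀ i, |((B i).2 : ℝ) - t i * ⟪v, p⟫| < min δ (1 / (1 + R)) := fun i => by
    have := (hA i).2.2.1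
    rw [hBA] at this
    exact (norm_snd_le _).trans_lt this
  have hsum1 : ∑ i, c i • intVec (B i).1 = v := by
    have := congrArg Prod.fst hsum
    simpa [hBA, Prod.fst_sum] using this
  have hsum2 : ∑ i, c i * ((B i).2 : ℝ) = ⟪v, p⟫ := by
    have := congrArg Prod.snd hsum
    simpa [hBA, Prod.snd_sum] using this
  let S : Set (Fin n → ℤ) := Set.range fun i => (B i).1
  have hcut : ∀ x ∈ cgClosureWith K S, ∀ i, ⟪intVec (B i).1, x⟫ ≤ (B i).2 := by
    intro x hx i
    refine inner_le_of_mem_cgClosureWith hK ⟨p, hp⟩ hx ⟨i, rfl⟩ fun y hy => ?_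
    have h1 := (abs_le.1 (abs_inner_le_of_norm_le (hnear i).le (hR y hy))).2
    rw [inner_sub_left, real_inner_smul_left] at h1
    have h2 := (abs_lt.1 (hnear' i)).1
    have h3 := mul_le_mul_of_nonneg_left (hmax y hy) (ht0 i).le
    have h4 : min δ (1 / (1 + R)) * (1 + R) ≤ 1 := by
      rw [← le_div_iff₀ (by positivity)]; exact min_le_right _ _
    nlinarith
  have hcomb : ∀ x, ⟪v, x⟫ - ⟪v, p⟫ = ∑ i, c i * (⟪intVec (B i).1, x⟫ - (B i).2) := by
    intro x
    simp only [mul_sub, Finset.sum_sub_distrib, hsum2]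
    conv_lhs => rw [← hsum1, sum_inner]
    simp only [real_inner_smul_left, hsum1]
  have hterm : ∀ x ∈ cgClosureWith K S, ∀ i ∈ Finset.univ,
      c i * (⟪intVec (B i).1, x⟫ - (B i).2) ≤ 0 := fun x hx i _ =>
    mul_nonpos_of_nonneg_of_nonpos (hc i).le (sub_nonpos.2 (hcut x hx i))
  refine ⟨S, Set.finite_range _, fun x hx => ?_, (B none).1, (B none).2, t none, hTt _,
    (hnear _).trans_le (min_le_left _ _), (hnear' _).trans_le (min_le_left _ _), fun x hx he => ?_⟩
  · rw [← sub_nonpos, hcomb]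
    exact Finset.sum_nonpos (hterm x hx)
  · have h0 : ∑ i, c i * (⟪intVec (B i).1, x⟫ - (B i).2) = 0 := by rw [← hcomb, he, sub_self]
    -- Equality makes every cut tight; the index `none` exists even when q = 0.
    have h1 := (Finset.sum_eq_zero_iff_of_nonpos (hterm x hx)).1 h0 none (Finset.mem_univ _)
    exact sub_eq_zero.1 ((mul_eq_zero.1 h1).resolve_left (hc none).ne')

/-- A point outside a compact convex set is strictly separated from its nearest point. -/
theorem exists_nearest_point {K : Set (𝔼 n)} (hK : IsCompact K) (hconv : Convex ℝ K)
    (hne : K.Nonempty) (x : 𝔼 n) : ∃ p ∈ K, (∀ y ∈ K, ‖x - p‖ ≤ ‖x - y‖) ∧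
      ∀ y ∈ K, ⟪x - p, y⟫ ≤ ⟪x - p, p⟫ := by
  obtain ⟨p, hp, h⟩ := exists_norm_eq_iInf_of_complete_convex hne hK.isComplete hconv x
  refine ⟨p, hp, fun y hy => ?_, fun y hy => ?_⟩
  · rw [h]
    exact ciInf_le ⟨0, by rintro _ ⟨z, rfl⟩; exact norm_nonneg _⟩ (⟨y, hy⟩ : K)
  · have := (norm_eq_iInf_iff_real_inner_le_zero hconv hp).1 h y hy
    rwa [inner_sub_right, sub_nonpos] at this

/-- The Chvátal–Gomory closure of a compact convex set is contained in it. -/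
theorem cgClosure_subset_self {K : Set (𝔼 n)} (hK : IsCompact K) (hconv : Convex ℝ K)
    (hne : K.Nonempty) : cgClosure K ⊆ K := by
  intro x hx
  obtain ⟨p, hp, -, hmax⟩ := exists_nearest_point hK hconv hne x
  obtain ⟨S, -, hS, -⟩ := exists_finite_cuts hK hp hmax 0 one_pos
  have h1 := hS x (cgClosure_subset S hx)
  rw [← sub_nonpos, ← inner_sub_right, real_inner_self_nonpos, sub_eq_zero] at h1
  rwa [h1]

/-! ### Lifting cuts from an exposed face -/

theorem isCompact_exposedFace {K : Set (𝔼 n)} (hK : IsCompact K) {v p : 𝔼 n} (hp : p ∈ K)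
    (hmax : ∀ y ∈ K, ⟪v, y⟫ ≤ ⟪v, p⟫) : IsCompact (exposedFace K v) := by
  have h : supportHyperplane K v = {x | ⟪v, x⟫ = ⟪v, p⟫} := by
    ext x; exact mem_supportHyperplane_iff hp hmax
  rw [exposedFace, h]
  exact hK.inter_right (isClosed_eq (by fun_prop) continuous_const)

theorem convex_exposedFace {K : Set (𝔼 n)} (hconv : Convex ℝ K) {v p : 𝔼 n} (hp : p ∈ K)
    (hmax : ∀ y ∈ K, ⟪v, y⟫ ≤ ⟪v, p⟫) : Convex ℝ (exposedFace K v) := by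
  have h : supportHyperplane K v = {x | ⟪v, x⟫ = ⟪v, p⟫} := by
    ext x; exact mem_supportHyperplane_iff hp hmax
  rw [exposedFace, h]
  exact hconv.inter (convex_hyperplane (innerₗ (𝔼 n) v).isLinear _)

/-- Far in the direction `v`, the support function of `K` is governed by the face exposed
by `v`. -/
theorem exists_forall_inner_add_smul_lt {K : Set (𝔼 n)} (hK : IsCompact K) {v p : 𝔼 n}
    (hmax : ∀ y ∈ K, ⟪v, y⟫ ≤ ⟪v, p⟫) (a : 𝔼 n) {M : ℝ}
    (hM : ∀ y ∈ K, ⟪v, y⟫ = ⟪v, p⟫ → ⟪a, y⟫ < M) :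
    ∃ T : ℝ, ∀ t, T < t → ∀ y ∈ K, ⟪a, y⟫ + t * ⟪v, y⟫ < t * ⟪v, p⟫ + M := by
  obtain ⟨R, hR0, hR⟩ := hK.isBounded.exists_pos_norm_le
  have hD : IsCompact (K ∩ {y | M ≤ ⟪a, y⟫}) :=
    hK.inter_right (isClosed_le continuous_const (by fun_prop))
  have hbound : ∀ y ∈ K, ⟪a, y⟫ ≤ ‖a‖ * R := fun y hy =>
    (le_abs_self _).trans (abs_inner_le_of_norm_le le_rfl (hR y hy))
  rcases (K ∩ {y | M ≤ ⟪a, y⟫}).eq_empty_or_nonempty with he | hne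
  · refine ⟨0, fun t ht y hy => ?_⟩
    have h1 : ⟪a, y⟫ < M := by
      by_contra! h
      exact Set.eq_empty_iff_forall_notMem.1 he y ⟨hy, h⟩
    have h2 := mul_le_mul_of_nonneg_left (hmax y hy) ht.le
    linarith
  -- On the compact part of K where a is at least M, v stays a positive gap below its maximum; a
  -- large t times this gap outweighs the bounded values of a.
  · obtain ⟨z, hz, hzmax⟩ := exists_forall_inner_le hD hne v
    have hη : 0 < ⟪v, p⟫ - ⟪v, z⟫ := by
      refine sub_pos.2 (lt_of_le_of_ne (hmax z hz.1) fun h => ?_)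
      exact (hM z hz.1 h).not_ge hz.2
    refine ⟨max 0 ((‖a‖ * R - M) / (⟪v, p⟫ - ⟪v, z⟫)), fun t ht y hy => ?_⟩
    have ht0 : 0 < t := (le_max_left _ _).trans_lt ht
    have ht1 := (le_max_right _ _).trans_lt ht
    rw [div_lt_iff₀ hη] at ht1
    rcases lt_or_ge ⟪a, y⟫ M with h1 | h1
    · have h2 := mul_le_mul_of_nonneg_left (hmax y hy) ht0.le
      linarith
    · have h2 := mul_le_mul_of_nonneg_left (hzmax y ⟨hy, h1⟩) ht0.le
      have h3 := hbound y hy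
      nlinarith

/-- If the closure of the face exposed by `v` is finitely generated, finitely many cuts for `K`
imply the inequality defining the face, and cut out the closure of the face on its hyperplane. -/
theorem exists_finite_lift {K : Set (𝔼 n)} (hK : IsCompact K) {v p : 𝔼 n} (hp : p ∈ K)
    (hmax : ∀ y ∈ K, ⟪v, y⟫ ≤ ⟪v, p⟫) (hF : FinitelyGenerated (exposedFace K v)) :
    ∃ S : Set (Fin n → ℤ), S.Finite ∧ (∀ x ∈ cgClosureWith K S, ⟪v, x⟫ ≤ ⟪v, p⟫) ∧
      ∀ x ∈ cgClosureWith K S, ⟪v, x⟫ = ⟪v, p⟫ → x ∈ cgClosure (exposedFace K v) := by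
  obtain ⟨R, hR0, hR⟩ := hK.isBounded.exists_pos_norm_le
  obtain ⟨T, hT, hFT⟩ := hF
  have hFc := isCompact_exposedFace hK hp hmax
  have hpF : p ∈ exposedFace K v := ⟨hp, (mem_supportHyperplane_iff hp hmax).2 rfl⟩
  choose f hfF hfmax using fun a : Fin n → ℤ => exists_forall_inner_le hFc ⟨p, hpF⟩ (intVec a)
  have hgap : ∀ a : Fin n → ℤ, 0 < ⌊⟪intVec a, f a⟫⌋ + 1 - ⟪intVec a, f a⟫ := fun a =>
    sub_pos.2 (Int.lt_floor_add_one _)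
  -- Half of the gap below the next integer pays for passing from the face to K, the other half for
  -- approximating t(v, h_K(v)) by (b, m).
  have hδ : ∃ δ > 0, ∀ a ∈ T, 2 * (δ * (1 + R)) < ⌊⟪intVec a, f a⟫⌋ + 1 - ⟪intVec a, f a⟫ := by
    have h1 : ∀ᶠ δ in 𝓝[>] (0 : ℝ), ∀ a ∈ T,
        2 * (δ * (1 + R)) < ⌊⟪intVec a, f a⟫⌋ + 1 - ⟪intVec a, f a⟫ := by
      refine (hT.eventually_all).2 fun a _ => ?_
      refine nhdsWithin_le_nhds (ContinuousAt.eventually_lt (by fun_prop) continuousAt_const ?_)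
      simp [hgap a]
    obtain ⟨δ, h2, h3⟩ := (h1.and self_mem_nhdsWithin).exists
    exact ⟨δ, h3, h2⟩
  obtain ⟨δ, hδ, hδT⟩ := hδ
  have hτ : ∀ a : Fin n → ℤ, ∃ τ : ℝ, ∀ t, τ < t → ∀ y ∈ K,
      ⟪intVec a, y⟫ + t * ⟪v, y⟫ < t * ⟪v, p⟫ + (⟪intVec a, f a⟫ + δ * (1 + R)) := fun a => by
    refine exists_forall_inner_add_smul_lt hK hmax (intVec a) fun y hy hvy => ?_
    have := hfmax a y ⟨hy, (mem_supportHyperplane_iff hp hmax).2 hvy⟩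
    have : 0 < δ * (1 + R) := by positivity
    linarith
  choose τ hτ using hτ
  obtain ⟨T₀, hT₀⟩ := (hT.image τ).bddAbove
  obtain ⟨S, hSfin, hS, b, m, t, ht, hb, hm, hSb⟩ := exists_finite_cuts hK hp hmax T₀ hδ
  refine ⟨S ∪ (fun a => a + b) '' T, hSfin.union (hT.image _), fun x hx =>
    hS x (cgClosureWith_anti Set.subset_union_left hx), fun x hx hvx => ?_⟩
  rw [hFT, mem_cgClosureWith_iff hFc ⟨p, hpF⟩]
  intro a ha
  refine ⟨f a, hfF a, hfmax a, ?_⟩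
  have h1 : ⟪intVec (a + b), x⟫ ≤ (⌊⟪intVec a, f a⟫⌋ + m : ℤ) := by
    refine inner_le_of_mem_cgClosureWith hK ⟨p, hp⟩ hx (Or.inr ⟨a, ha, rfl⟩) fun y hy => ?_
    have h2 := hτ a t ((hT₀ ⟨a, ha, rfl⟩).trans_lt ht) y hy
    have h3 := (abs_le.1 (abs_inner_le_of_norm_le hb.le (hR y hy))).2
    rw [inner_sub_left, real_inner_smul_left] at h3
    have h4 := (abs_lt.1 hm).1
    have h5 := hδT a ha
    rw [intVec_add, inner_add_left]
    push_cast
    nlinarith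
  have h2 := hSb x (cgClosureWith_anti Set.subset_union_left hx) hvx
  rw [intVec_add, inner_add_left, h2] at h1
  push_cast at h1
  linarith

/-! ### Polyhedra and perturbation of the direction -/

/-- If `x` maximizes a linear functional over a polyhedron and `y` satisfies with equality every
inequality that is tight at `x`, then the functional is at least as large at `y`. -/
theorem inner_le_of_forall_tight {ι : Type*} {I : Set ι} (hI : I.Finite) (A : ι → 𝔼 n) (β : ι → ℝ)
    {u x y : 𝔼 n} (hx : ∀ i ∈ I, ⟪A i, x⟫ ≤ β i)
    (hxmax : ∀ z, (∀ i ∈ I, ⟪A i, z⟫ ≤ β i) → ⟪u, z⟫ ≤ ⟪u, x⟫)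
    (htight : ∀ i ∈ I, ⟪A i, x⟫ = β i → ⟪A i, y⟫ = β i) : ⟪u, x⟫ ≤ ⟪u, y⟫ := by
  -- A short move from x away from y stays feasible: slack constraints stay slack, tight ones are
  -- constant on the line.
  have h1 : ∀ᶠ s in 𝓝[>] (0 : ℝ), ∀ i ∈ I, ⟪A i, x + s • (x - y)⟫ ≤ β i := by
    refine (hI.eventually_all).2 fun i hi => ?_
    rcases (hx i hi).lt_or_eq with h | h
    · refine nhdsWithin_le_nhds ((ContinuousAt.eventually_lt (f := fun s : ℝ =>
        ⟪A i, x + s • (x - y)⟫) (by fun_prop) continuousAt_const ?_).mono fun _ => le_of_lt)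
      simpa using h
    · refine Eventually.of_forall fun s => ?_
      rw [inner_add_right, real_inner_smul_right, inner_sub_right, htight i hi h, h]
      simp
  obtain ⟨s, hs, hs0⟩ := (h1.and self_mem_nhdsWithin).exists
  have h2 := hxmax _ hs
  rw [inner_add_right, real_inner_smul_right, inner_sub_right] at h2
  have hs0 : 0 < s := hs0
  nlinarith

/-- For `u` near `v`, a maximizer of `u` over a polyhedron valid for `v` either lies on the
hyperplane of `v` or stays below the value of `u` at `p`. -/
theorem eventually_maximizer {ι : Type*} {I : Set ι} (hI : I.Finite) (A : ι → 𝔼 n) (β : ι → ℝ)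
    {v p : 𝔼 n} (hv : ∀ x, (∀ i ∈ I, ⟪A i, x⟫ ≤ β i) → ⟪v, x⟫ ≤ ⟪v, p⟫) :
    ∀ᶠ u in 𝓝 v, ∀ x, (∀ i ∈ I, ⟪A i, x⟫ ≤ β i) →
      (∀ z, (∀ i ∈ I, ⟪A i, z⟫ ≤ β i) → ⟪u, z⟫ ≤ ⟪u, x⟫) → ⟪u, x⟫ < ⟪u, p⟫ ∨ ⟪v, x⟫ = ⟪v, p⟫ := by
  have h1 : ∀ᶠ u in 𝓝 v, ∀ J ∈ I.powerset, ∀ x, (∀ i ∈ I, ⟪A i, x⟫ ≤ β i) →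
      (∀ z, (∀ i ∈ I, ⟪A i, z⟫ ≤ β i) → ⟪u, z⟫ ≤ ⟪u, x⟫) →
      (∀ i ∈ I, ⟪A i, x⟫ = β i ↔ i ∈ J) → ⟪u, x⟫ < ⟪u, p⟫ ∨ ⟪v, x⟫ = ⟪v, p⟫ := by
    refine (hI.finite_subsets.eventually_all).2 fun J _ => ?_
    -- If some feasible y strictly below the hyperplane has tight set J, every maximizer with tight
    -- set J has u-value at most ⟪u, y⟫, which stays below ⟪u, p⟫ for u near v.
    by_cases hJ : ∃ y, (∀ i ∈ I, ⟪A i, y⟫ ≤ β i) ∧ (∀ i ∈ I, ⟪A i, y⟫ = β i ↔ i ∈ J) ∧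
        ⟪v, y⟫ < ⟪v, p⟫
    · obtain ⟨y, hy, hyJ, hyv⟩ := hJ
      have h2 : ∀ᶠ u in 𝓝 v, ⟪u, y⟫ < ⟪u, p⟫ :=
        ContinuousAt.eventually_lt (by fun_prop) (by fun_prop) hyv
      filter_upwards [h2] with u hu x hx hxmax hxJ
      refine Or.inl ((inner_le_of_forall_tight hI A β hx hxmax fun i hi h => ?_).trans_lt hu)
      exact (hyJ i hi).2 ((hxJ i hi).1 h)
    · push Not at hJ
      refine Eventually.of_forall fun u x hx _ hxJ => Or.inr ?_
      exact le_antisymm (hv x hx) (hJ x hx hxJ)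
  filter_upwards [h1] with u hu x hx hxmax
  exact hu {i ∈ I | ⟪A i, x⟫ = β i} (Set.sep_subset _ _) x hx hxmax fun i hi => by simp [hi]

/-- Finitely many coordinate cuts bound the closure. -/
theorem isBounded_cgClosureWith {K : Set (𝔼 n)} (hK : IsCompact K) (hne : K.Nonempty) :
    ∃ S : Set (Fin n → ℤ), S.Finite ∧ Bornology.IsBounded (cgClosureWith K S) := by
  obtain ⟨R, hR0, hR⟩ := hK.isBounded.exists_pos_norm_le
  let e : Fin n → Fin n → ℤ := fun i => Pi.single i 1
  have he : ∀ i (x : 𝔼 n), ⟪intVec (e i), x⟫ = x i := fun i x => by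
    simp [inner_intVec, e, Pi.single_apply]
  have hyR : ∀ y ∈ K, ∀ i, |y i| ≤ R := fun y hy i => (PiLp.norm_apply_le y i).trans (hR y hy)
  refine ⟨Set.range e ∪ Set.range fun i => -e i, (Set.finite_range _).union (Set.finite_range _),
    ?_⟩
  have hcoord : ∀ x ∈ cgClosureWith K (Set.range e ∪ Set.range fun i => -e i), ∀ i,
      |x i| ≤ (⌈R⌉ : ℤ) := by
    intro x hx i
    have hc : R < (⌈R⌉ : ℝ) + 1 := (Int.le_ceil R).trans_lt (lt_add_one _)
    have h1 : ⟪intVec (e i), x⟫ ≤ (⌈R⌉ : ℤ) :=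
      inner_le_of_mem_cgClosureWith hK hne hx (Or.inl ⟨i, rfl⟩) fun y hy => by
        rw [he]; exact ((abs_le.1 (hyR y hy i)).2).trans_lt hc
    have h2 : ⟪intVec (-e i), x⟫ ≤ (⌈R⌉ : ℤ) :=
      inner_le_of_mem_cgClosureWith hK hne hx (Or.inr ⟨i, rfl⟩) fun y hy => by
        rw [intVec_neg, inner_neg_left, he]
        linarith [(abs_le.1 (hyR y hy i)).1]
    rw [he] at h1
    rw [intVec_neg, inner_neg_left, he] at h2
    exact abs_le.2 ⟨by linarith, h1⟩
  refine isBounded_iff_forall_norm_le.2 ⟨√(∑ _i : Fin n, (⌈R⌉ : ℝ) ^ 2), fun x hx => ?_⟩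
  rw [EuclideanSpace.norm_eq]
  refine Real.sqrt_le_sqrt (Finset.sum_le_sum fun i _ => ?_)
  exact pow_le_pow_left₀ (norm_nonneg _) (hcoord x hx i) 2

theorem isClosed_cgClosureWith {K : Set (𝔼 n)} (S : Set (Fin n → ℤ)) :
    IsClosed (cgClosureWith K S) := by
  refine isClosed_biInter fun a _ => isClosed_le ?_ continuous_const
  exact continuous_coe_real_ereal.comp (by fun_prop)

/-- Locally uniform version of `exists_finite_lift`: one finite set of cuts serves all
directions near `v`. -/
theorem exists_finite_eventually {K : Set (𝔼 n)} (hK : IsCompact K) (hconv : Convex ℝ K)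
    (hne : K.Nonempty) {v : 𝔼 n} (hF : FinitelyGenerated (exposedFace K v)) :
    ∃ S : Set (Fin n → ℤ), S.Finite ∧ ∀ᶠ u in 𝓝 v, ∀ q ∈ K, (∀ y ∈ K, ⟪u, y⟫ ≤ ⟪u, q⟫) →
      ∀ x ∈ cgClosureWith K S, ⟪u, x⟫ ≤ ⟪u, q⟫ ∧ (⟪u, x⟫ = ⟪u, q⟫ → x ∈ cgClosure K) := by
  obtain ⟨p, hp, hmax⟩ := exists_forall_inner_le hK hne v
  obtain ⟨S₁, hS₁, hv₁, hF₁⟩ := exists_finite_lift hK hp hmax hF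
  obtain ⟨S₂, hS₂, hb⟩ := isBounded_cgClosureWith hK hne
  refine ⟨S₁ ∪ S₂, hS₁.union hS₂, ?_⟩
  have hcomp : IsCompact (cgClosureWith K (S₁ ∪ S₂)) :=
    Metric.isCompact_of_isClosed_isBounded (isClosed_cgClosureWith _)
      (hb.subset (cgClosureWith_anti Set.subset_union_right))
  choose f hfK hfmax using fun a : Fin n → ℤ => exists_forall_inner_le hK hne (intVec a)
  have hmem : ∀ x, x ∈ cgClosureWith K (S₁ ∪ S₂) ↔
      ∀ a ∈ S₁ ∪ S₂, ⟪intVec a, x⟫ ≤ (⌊⟪intVec a, f a⟫⌋ : ℝ) := fun x => by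
    simp only [cgClosureWith, Set.mem_iInter, Set.mem_ofPred_eq]
    refine forall₂_congr fun a _ => ?_
    rw [supportFun_eq_of_forall_le (hfK a) (hfmax a), erealFloor_coe, EReal.coe_le_coe_iff]
  have hpF : p ∈ exposedFace K v := ⟨hp, (mem_supportHyperplane_iff hp hmax).2 rfl⟩
  have hFc := isCompact_exposedFace hK hp hmax
  have hev := eventually_maximizer (hS₁.union hS₂) (fun a => intVec a)
    (fun a => (⌊⟪intVec a, f a⟫⌋ : ℝ)) (v := v) (p := p)
    fun x hx => hv₁ x (cgClosureWith_anti Set.subset_union_left ((hmem x).2 hx))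
  simp only [← hmem] at hev
  filter_upwards [hev] with u hu q hq hqmax x hx
  have key : ∀ z ∈ cgClosureWith K (S₁ ∪ S₂),
      (∀ y ∈ cgClosureWith K (S₁ ∪ S₂), ⟪u, y⟫ ≤ ⟪u, z⟫) →
      ⟪u, z⟫ < ⟪u, q⟫ ∨ (⟪u, z⟫ ≤ ⟪u, q⟫ ∧ z ∈ cgClosure K) := by
    intro z hz hzmax
    rcases hu z hz hzmax with h | h
    · exact Or.inl (h.trans_le (hqmax p hp))
    · have h1 := hF₁ z (cgClosureWith_anti Set.subset_union_left hz) h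
      have h2 := cgClosure_subset_self hFc (convex_exposedFace hconv hp hmax) ⟨p, hpF⟩ h1
      exact Or.inr ⟨hqmax z h2.1, cgClosure_mono hFc ⟨p, hpF⟩ hK Set.inter_subset_left h1⟩
  obtain ⟨z, hz, hzmax⟩ := exists_forall_inner_le hcomp ⟨x, hx⟩ u
  have hzq : ⟪u, z⟫ ≤ ⟪u, q⟫ := (key z hz hzmax).elim le_of_lt And.left
  refine ⟨(hzmax x hx).trans hzq, fun h => ?_⟩
  -- At equality x is itself a maximizer of u, so `key` applies to it.
  rcases key x hx (fun y hy => (hzmax y hy).trans (h ▸ hzq)) with h' | h'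
  · exact absurd h h'.ne
  · exact h'.2

/-! ### Support at the relative boundary -/

/-- Relative boundary points of a compact convex set have a supporting unit vector in the
direction of the affine span. -/
theorem exists_unit_support_of_mem_intrinsicFrontier {K : Set (𝔼 n)} (hK : IsCompact K)
    (hconv : Convex ℝ K) {x : 𝔼 n} (hx : x ∈ intrinsicFrontier ℝ K) :
    ∃ u ∈ (affineSpan ℝ K).direction, ‖u‖ = 1 ∧ x ∈ K ∧ ∀ y ∈ K, ⟪u, y⟫ ≤ ⟪u, x⟫ := by
  have hxK : x ∈ K := intrinsicFrontier_subset hK.isClosed hx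
  obtain ⟨x', hx', rfl⟩ := mem_intrinsicFrontier.1 hx
  have hout : ∀ k : ℕ, ∃ z ∈ affineSpan ℝ K, z ∉ K ∧ dist z x' < 1 / (k + 1) := by
    intro k
    rw [frontier_eq_closure_inter_closure] at hx'
    obtain ⟨z, hz, hzx⟩ := Metric.mem_closure_iff.1 hx'.2 (1 / (k + 1)) (by positivity)
    exact ⟨z, z.2, hz, by rwa [dist_comm] at hzx⟩
  choose z hzA hzK hzx using hout
  choose p hpK hpnear hpmax using fun k => exists_nearest_point hK hconv ⟨_, hxK⟩ (z k)
  have hpos : ∀ k, ‖z k - p k‖ ≠ 0 := fun k h => by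
    rw [norm_eq_zero, sub_eq_zero] at h
    exact hzK k (h ▸ hpK k)
  let u : ℕ → 𝔼 n := fun k => ‖z k - p k‖⁻¹ • (z k - p k)
  have hu1 : ∀ k, u k ∈ Metric.sphere (0 : 𝔼 n) 1 := fun k => by
    simp [u, norm_smul, inv_mul_cancel₀ (hpos k)]
  -- The support vector is a limit of unit normals at the points of K nearest to outside points of
  -- the affine hull tending to x'.
  obtain ⟨w, hw, φ, hφ, hlim⟩ := (isCompact_sphere (0 : 𝔼 n) 1).tendsto_subseq hu1
  have hz : Tendsto z atTop (𝓝 (x' : 𝔼 n)) :=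
    tendsto_iff_dist_tendsto_zero.2 (squeeze_zero (fun _ => dist_nonneg) (fun k => (hzx k).le)
      tendsto_one_div_add_atTop_nhds_zero_nat)
  have hp : Tendsto p atTop (𝓝 (x' : 𝔼 n)) := by
    have h1 : Tendsto (fun k => dist (p k) (z k)) atTop (𝓝 0) := by
      refine squeeze_zero (fun _ => dist_nonneg) (fun k => ?_) (tendsto_iff_dist_tendsto_zero.1 hz)
      rw [dist_comm, dist_eq_norm, dist_eq_norm]
      exact hpnear k _ hxK
    exact (tendsto_iff_of_dist h1).2 hz
  refine ⟨w, ?_, by simpa using hw, hxK, fun y hy => ?_⟩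
  · refine (Submodule.closed_of_finiteDimensional (affineSpan ℝ K).direction).mem_of_tendsto hlim
      (Eventually.of_forall fun k => ?_)
    exact Submodule.smul_mem _ _ (AffineSubspace.vsub_mem_direction (hzA _)
      (subset_affineSpan ℝ K (hpK _)))
  · refine le_of_tendsto_of_tendsto' (hlim.inner tendsto_const_nhds)
      (hlim.inner (hp.comp hφ.tendsto_atTop)) fun k => ?_
    simp only [u, Function.comp_apply, real_inner_smul_left]
    exact mul_le_mul_of_nonneg_left (hpmax _ y hy) (by positivity)

/-! ### The integral affine hull -/

/-- A saturated subgroup of `ℤⁿ` is the kernel of an endomorphism that is the identity modulo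
the subgroup. -/
theorem exists_projection_of_saturated (Λ : Submodule ℤ (Fin n → ℤ))
    (hΛ : ∀ (k : ℤ) (a : Fin n → ℤ), k ≠ 0 → k • a ∈ Λ → a ∈ Λ) :
    ∃ ρ : (Fin n → ℤ) →ₗ[ℤ] (Fin n → ℤ), (∀ a ∈ Λ, ρ a = 0) ∧ ∀ a, a - ρ a ∈ Λ := by
  have htf : Module.IsTorsionFree ℤ ((Fin n → ℤ) ⧸ Λ) := by
    refine Module.IsTorsionFree.of_smul_eq_zero fun k y h => ?_
    obtain ⟨a, rfl⟩ := Λ.mkQ_surjective y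
    rw [← map_smul, Submodule.mkQ_apply, Submodule.Quotient.mk_eq_zero] at h
    rw [or_iff_not_imp_left, Submodule.mkQ_apply, Submodule.Quotient.mk_eq_zero]
    exact fun hk => hΛ k a hk h
  -- A finitely generated torsion-free quotient is free, so the quotient map splits.
  have hfree : Module.Free ℤ ((Fin n → ℤ) ⧸ Λ) := Module.free_of_finite_type_torsion_free'
  obtain ⟨s, hs⟩ := Module.projective_lifting_property Λ.mkQ LinearMap.id Λ.mkQ_surjective
  refine ⟨s ∘ₗ Λ.mkQ, fun a ha => ?_, fun a => ?_⟩
  · rw [LinearMap.comp_apply, Submodule.mkQ_apply, (Submodule.Quotient.mk_eq_zero _).2 ha, map_zero]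
  · rw [← Submodule.Quotient.mk_eq_zero, ← Submodule.mkQ_apply, map_sub, LinearMap.comp_apply]
    have := LinearMap.congr_fun hs (Λ.mkQ a)
    rw [LinearMap.comp_apply] at this
    rw [this, LinearMap.id_apply, sub_self]

/-- A point on which a saturated group of integral functionals takes integral values lies in the
affine span of the integer points with the same values. -/
theorem mem_affineSpan_inter_of_integral (A : AffineSubspace ℝ (𝔼 n))
    (Λ : Submodule ℤ (Fin n → ℤ))
    (hΛ : ∀ (k : ℤ) (a : Fin n → ℤ), k ≠ 0 → k • a ∈ Λ → a ∈ Λ) {x : 𝔼 n}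
    (hx : ∀ a ∈ Λ, ∃ m : ℤ, ⟪intVec a, x⟫ = m)
    (hA : ∀ y, (∀ a ∈ Λ, ⟪intVec a, y⟫ = ⟪intVec a, x⟫) → y ∈ A) :
    x ∈ affineSpan ℝ ((A : Set (𝔼 n)) ∩ Set.range intVec) := by
  obtain ⟨ρ, hρ0, hρ⟩ := exists_projection_of_saturated Λ hΛ
  let e : Fin n → Fin n → ℤ := fun j => Pi.single j 1
  -- The d i are the images of the unit vectors under the transpose of ρ. Then z = x - ρᵀx is an
  -- integer point, as ⟪a, z⟫ = ⟪a - ρ a, x⟫ with a - ρ a ∈ Λ, and each d i is an integer vector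
  -- killed by Λ; so x = z + ∑ x i • d i lies in the required span.
  let d : Fin n → Fin n → ℤ := fun i j => ρ (e j) i
  have hsum : ∀ (y : 𝔼 n) (a : Fin n → ℤ),
      ⟪intVec a, ∑ i, y i • intVec (d i)⟫ = ⟪intVec (ρ a), y⟫ := by
    intro y a
    have h1 : ρ a = ∑ j, a j • ρ (e j) := by
      have h0 : a = ∑ j, a j • e j := by
        funext i; simp [e, Finset.sum_apply, Pi.single_apply]
      conv_lhs => rw [h0]
      simp only [map_sum, map_smul]
    simp only [inner_sum, real_inner_smul_right, inner_intVec]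
    refine Finset.sum_congr rfl fun i _ => ?_
    simp [h1, d, intVec, mul_comm]
  set z : 𝔼 n := x - ∑ i, x i • intVec (d i) with hz
  have hz_inner : ∀ a, ⟪intVec a, z⟫ = ⟪intVec (a - ρ a), x⟫ := fun a => by
    rw [hz, inner_sub_right, hsum, intVec_sub, inner_sub_left]
  choose m hm using fun a => hx _ (hρ a)
  have hz_int : z = intVec fun j => m (e j) := by
    ext j
    have h1 : ⟪intVec (e j), z⟫ = z j := by simp [inner_intVec, e, Pi.single_apply]
    rw [← h1, hz_inner, hm]
    simp [intVec]
  have hd : ∀ i, ∀ a ∈ Λ, ⟪intVec a, intVec (d i)⟫ = 0 := fun i a ha => by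
    have h1 := hsum (EuclideanSpace.single i 1) a
    rw [hρ0 a ha] at h1
    have h2 : (intVec (0 : Fin n → ℤ) : 𝔼 n) = 0 := (intVecHom n).map_zero
    simpa [h2, ite_smul] using h1
  have hzx : ∀ a ∈ Λ, ⟪intVec a, z⟫ = ⟪intVec a, x⟫ := fun a ha => by
    rw [hz_inner, hρ0 a ha, sub_zero]
  have hzmem : z ∈ affineSpan ℝ ((A : Set (𝔼 n)) ∩ Set.range intVec) :=
    subset_affineSpan ℝ _ ⟨hA z hzx, _, hz_int.symm⟩
  have hdmem : ∀ i, intVec (d i) ∈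
      (affineSpan ℝ ((A : Set (𝔼 n)) ∩ Set.range intVec)).direction := fun i => by
    have h1 : z + intVec (d i) ∈ affineSpan ℝ ((A : Set (𝔼 n)) ∩ Set.range intVec) := by
      refine subset_affineSpan ℝ _ ⟨hA _ fun a ha => ?_, (fun j => m (e j)) + d i, ?_⟩
      · rw [inner_add_right, hd i a ha, add_zero, hzx a ha]
      · rw [intVec_add, ← hz_int]
    have h2 := AffineSubspace.vsub_mem_direction h1 hzmem
    rwa [vsub_eq_sub, add_sub_cancel_left] at h2
  have h1 := AffineSubspace.vadd_mem_of_mem_direction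
    (Submodule.sum_mem _ fun i _ => Submodule.smul_mem _ (x i) (hdmem i) :
      ∑ i, x i • intVec (d i) ∈ _) hzmem
  rwa [vadd_eq_add, hz, add_sub_cancel] at h1

/-- The integer vectors at distance less than `δ` from a subspace. -/
def intNear (W : Submodule ℝ (𝔼 n)) (δ : ℝ) : Set (Fin n → ℤ) :=
  {a | ∃ w ∈ W, ‖intVec a - w‖ < δ}

theorem intNear_mono (W : Submodule ℝ (𝔼 n)) {δ ε : ℝ} (h : δ ≤ ε) :
    intNear W δ ⊆ intNear W ε :=
  fun _ ⟨w, hw, ha⟩ => ⟨w, hw, ha.trans_le h⟩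

/-- For small `δ` the real span of the integer vectors `δ`-close to `W` does not depend
on `δ`. -/
theorem exists_span_intNear_eq (W : Submodule ℝ (𝔼 n)) {ε : ℝ} (hε : 0 < ε) :
    ∃ δ, 0 < δ ∧ δ ≤ ε ∧ ∀ δ', 0 < δ' → δ' ≤ δ →
      Submodule.span ℝ (intVec '' intNear W δ') = Submodule.span ℝ (intVec '' intNear W δ) := by
  obtain ⟨_, ⟨δ, ⟨hδ, hδε⟩, rfl⟩, hmin⟩ := WellFounded.has_min
    (wellFounded_lt (α := Submodule ℝ (𝔼 n)))
    ((fun δ => Submodule.span ℝ (intVec '' intNear W δ)) '' Set.Ioc 0 ε) ⟨_, ε, ⟨hε, le_rfl⟩, rfl⟩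
  refine ⟨δ, hδ, hδε, fun δ' h0 h1 => ?_⟩
  have hle : Submodule.span ℝ (intVec '' intNear W δ') ≤ Submodule.span ℝ (intVec '' intNear W δ) :=
    Submodule.span_mono (Set.image_mono (intNear_mono W h1))
  exact (hle.lt_or_eq.resolve_left (hmin _ ⟨δ', ⟨h0, h1.trans hδε⟩, rfl⟩))

/-- Integer vectors approximating large multiples of w ∈ W are themselves close to W. -/
theorem le_span_intNear (W : Submodule ℝ (𝔼 n)) {δ : ℝ} (hδ : 0 < δ) :
    W ≤ Submodule.span ℝ (intVec '' intNear W δ) := by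
  intro w hw
  refine mem_submodule_of_near_smul _ w δ fun T => ?_
  obtain ⟨t, ht, _, ⟨a, rfl⟩, ha⟩ :=
    exists_mem_near_smul (intVecHom n).range (intVec_cocompact n) w T hδ
  exact ⟨t, ht, _, Submodule.subset_span ⟨a, ⟨t • w, W.smul_mem _ hw, ha⟩, rfl⟩, ha⟩

/-- The integer vectors close to `W` generate all integer vectors of their real span, once this
span is stable. -/
theorem mem_span_intNear (W : Submodule ℝ (𝔼 n)) {δ : ℝ} (hδ : 0 < δ)
    (hstable : ∀ δ', 0 < δ' → δ' ≤ δ →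
      Submodule.span ℝ (intVec '' intNear W δ') = Submodule.span ℝ (intVec '' intNear W δ))
    {a : Fin n → ℤ} (ha : intVec a ∈ Submodule.span ℝ (intVec '' intNear W δ)) :
    a ∈ Submodule.span ℤ (intNear W δ) := by
  have hδ' : 0 < δ / (n + 1) := by positivity
  have hδle : δ / (n + 1) ≤ δ := div_le_self hδ.le (by linarith [(Nat.cast_nonneg n : (0 : ℝ) ≤ n)])
  rw [← hstable _ hδ' hδle] at ha
  obtain ⟨q, hq, f, hf, hspan⟩ : ∃ q ≤ n, ∃ f : Fin q → 𝔼 n,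
      (∀ i, f i ∈ intVec '' intNear W (δ / (n + 1))) ∧ Submodule.span ℝ (Set.range f) =
        Submodule.span ℝ (intVec '' intNear W (δ / (n + 1))) := by
    obtain ⟨f, hf, hspan, -⟩ :=
      Submodule.exists_fun_fin_finrank_span_eq ℝ (intVec '' intNear W (δ / (n + 1)))
    exact ⟨_, (Submodule.finrank_le _).trans (by simp), f, hf, hspan⟩
  choose g hg hgf using hf
  rw [← hspan] at ha
  obtain ⟨r, hr⟩ := (Submodule.mem_span_range_iff_exists_fun ℝ).1 ha
  choose w hw hgw using hg
  have h1 : ∑ i, ⌊r i⌋ • g i ∈ Submodule.span ℤ (intNear W δ) :=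
    Submodule.sum_mem _ fun i _ => Submodule.smul_mem _ _
      (Submodule.subset_span (intNear_mono W hδle ⟨w i, hw i, hgw i⟩))
  -- At most n fractional parts, each with error at most δ / (n + 1), keep the remainder within δ of
  -- W.
  have h2 : a - ∑ i, ⌊r i⌋ • g i ∈ intNear W δ := by
    refine ⟨∑ i, Int.fract (r i) • w i,
      Submodule.sum_mem _ fun i _ => Submodule.smul_mem _ _ (hw i), ?_⟩
    have h3 : intVec (a - ∑ i, ⌊r i⌋ • g i) - ∑ i, Int.fract (r i) • w i
        = ∑ i, Int.fract (r i) • (intVec (g i) - w i) := by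
      have h4 : intVec (∑ i, ⌊r i⌋ • g i) = ∑ i, (⌊r i⌋ : ℝ) • intVec (g i) := by
        refine (map_sum (intVecHom n) _ _).trans (Finset.sum_congr rfl fun i _ => ?_)
        exact intVec_zsmul _ _
      rw [intVec_sub, h4, ← hr]
      simp only [← hgf, smul_sub, Finset.sum_sub_distrib, Int.fract, sub_smul]
    rw [h3]
    calc ‖∑ i, Int.fract (r i) • (intVec (g i) - w i)‖
        ≤ ∑ _i : Fin q, δ / (n + 1) := by
          refine (norm_sum_le _ _).trans (Finset.sum_le_sum fun i _ => ?_)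
          rw [norm_smul, Real.norm_of_nonneg (Int.fract_nonneg _)]
          exact (mul_le_of_le_one_left (norm_nonneg _) (Int.fract_lt_one _).le).trans (hgw i).le
      _ = q * (δ / (n + 1)) := by simp
      _ ≤ n * (δ / (n + 1)) := by gcongr
      _ < δ := by
          rw [mul_div_assoc', div_lt_iff₀ (by positivity)]
          nlinarith
  have h3 := Submodule.add_mem _ (Submodule.subset_span h2) h1
  simpa using h3

/-- Finitely many cuts confine the closure to the affine hull. -/
theorem exists_finite_subset_affineSpan {K : Set (𝔼 n)} (hK : IsCompact K) (hne : K.Nonempty) :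
    ∃ S : Set (Fin n → ℤ), S.Finite ∧ cgClosureWith K S ⊆ affineSpan ℝ K := by
  obtain ⟨p, hp⟩ := hne
  have hpA : p ∈ affineSpan ℝ K := subset_affineSpan ℝ K hp
  obtain ⟨f, hf, hspan, -⟩ := Submodule.exists_fun_fin_finrank_span_eq ℝ
    ((affineSpan ℝ K).directionᗮ : Set (𝔼 n))
  replace hspan := hspan.trans (Submodule.span_eq _)
  have hconst : ∀ i, ∀ y ∈ K, ⟪f i, y⟫ = ⟪f i, p⟫ := fun i y hy => by
    have h1 := Submodule.inner_left_of_mem_orthogonal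
      (AffineSubspace.vsub_mem_direction (subset_affineSpan ℝ K hy) hpA) (hf i)
    rwa [vsub_eq_sub, inner_sub_right, sub_eq_zero] at h1
  choose S hS hS1 using fun i => exists_finite_cuts hK hp (fun y hy => (hconst i y hy).le) 0 one_pos
  choose S' hS' hS1' using fun i => exists_finite_cuts (v := -f i) hK hp
    (fun y hy => by rw [inner_neg_left, inner_neg_left, hconst i y hy]) 0 one_pos
  refine ⟨⋃ i, S i ∪ S' i, Set.finite_iUnion fun i => (hS i).union (hS' i), fun x hx => ?_⟩
  have heq : ∀ i, ⟪f i, x - p⟫ = 0 := fun i => by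
    have h1 := (hS1 i).1 x (cgClosureWith_anti
      (Set.subset_union_left.trans (Set.subset_iUnion (fun i => S i ∪ S' i) i)) hx)
    have h2 := (hS1' i).1 x (cgClosureWith_anti
      (Set.subset_union_right.trans (Set.subset_iUnion (fun i => S i ∪ S' i) i)) hx)
    rw [inner_neg_left, inner_neg_left] at h2
    rw [inner_sub_right]
    linarith
  have hle : (affineSpan ℝ K).directionᗮ ≤ (ℝ ∙ (x - p))ᗮ := by
    rw [← hspan, Submodule.span_le]
    rintro _ ⟨i, rfl⟩
    exact Submodule.mem_orthogonal_singleton_iff_inner_left.2 (heq i)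
  have hmem : x - p ∈ (affineSpan ℝ K).direction := by
    rw [← Submodule.orthogonal_orthogonal (affineSpan ℝ K).direction, Submodule.mem_orthogonal]
    exact fun w hw => Submodule.mem_orthogonal_singleton_iff_inner_left.1 (hle hw)
  simpa using AffineSubspace.vadd_mem_of_mem_direction hmem hpA

/-- Finitely many cuts confine the closure to the integral affine hull. -/
theorem exists_finite_subset_affI {K : Set (𝔼 n)} (hK : IsCompact K) (hne : K.Nonempty) :
    ∃ S : Set (Fin n → ℤ), S.Finite ∧ cgClosureWith K S ⊆ affI K := by
  obtain ⟨S₁, hS₁, hA⟩ := exists_finite_subset_affineSpan hK hne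
  obtain ⟨R, hR0, hR⟩ := hK.isBounded.exists_pos_norm_le
  set W := (affineSpan ℝ K).directionᗮ with hW
  -- With δ ≤ 1 / (4R), K has width at most 2δR ≤ 1 / 2 along each nearby integer vector.
  obtain ⟨δ, hδ, hδR, hstable⟩ := exists_span_intNear_eq W (ε := 1 / (4 * R)) (by positivity)
  rw [le_div_iff₀ (by positivity)] at hδR
  -- There may be infinitely many nearby integer vectors, but finitely many generate their ℤ-span.
  obtain ⟨S₂, hS₂, hS₂span⟩ := (Submodule.fg_span_iff_fg_span_finset_subset (intNear W δ)).1
    (IsNoetherian.noetherian (R := ℤ) _)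
  refine ⟨S₁ ∪ (S₂ ∪ (fun a => -a) '' (S₂ : Set (Fin n → ℤ))),
    hS₁.union (S₂.finite_toSet.union (S₂.finite_toSet.image _)), fun x hx => ?_⟩
  have hxA : x ∈ affineSpan ℝ K := hA (cgClosureWith_anti Set.subset_union_left hx)
  have hint : ∀ a ∈ S₂, ∃ m : ℤ, ⟪intVec a, x⟫ = m := by
    intro a ha
    obtain ⟨w, hw, haw⟩ := hS₂ ha
    obtain ⟨p, hp, -, hxp⟩ := (mem_cgClosureWith_iff hK hne).1 hx a (Or.inr (Or.inl ha))
    obtain ⟨q, hq, -, hxq⟩ :=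
      (mem_cgClosureWith_iff hK hne).1 hx (-a) (Or.inr (Or.inr ⟨a, ha, rfl⟩))
    rw [intVec_neg, inner_neg_left, inner_neg_left] at hxq
    have h1 := Submodule.inner_left_of_mem_orthogonal (AffineSubspace.vsub_mem_direction
      (subset_affineSpan ℝ K hp) (subset_affineSpan ℝ K hq)) hw
    rw [vsub_eq_sub, inner_sub_right] at h1
    have h2 := (abs_le.1 (abs_inner_le_of_norm_le haw.le (hR p hp))).2
    have h3 := (abs_le.1 (abs_inner_le_of_norm_le haw.le (hR q hq))).1
    rw [inner_sub_left] at h2 h3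
    have h4 := Int.floor_le ⟪intVec a, p⟫
    have h5 := Int.floor_le (-⟪intVec a, q⟫)
    -- The two floors have integer sum below 1, hence at most 0, while both cuts holding at x make
    -- it nonnegative; so ⟪a, x⟫ is the first floor.
    have h6 : ⌊⟪intVec a, p⟫⌋ + ⌊-⟪intVec a, q⟫⌋ < 1 := by
      have : ((⌊⟪intVec a, p⟫⌋ + ⌊-⟪intVec a, q⟫⌋ : ℤ) : ℝ) < 1 := by push_cast; linarith
      exact_mod_cast this
    have h7 : ((⌊⟪intVec a, p⟫⌋ + ⌊-⟪intVec a, q⟫⌋ : ℤ) : ℝ) ≤ 0 := by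
      exact_mod_cast Int.lt_add_one_iff.1 (by simpa using h6)
    push_cast at h7
    exact ⟨⌊⟪intVec a, p⟫⌋, by linarith⟩
  let Y := Submodule.span ℝ (intVec '' intNear W δ)
  let Λ : Submodule ℤ (Fin n → ℤ) := AddSubgroup.toIntSubmodule (Y.toAddSubgroup.comap (intVecHom n))
  have hΛ : ∀ a, a ∈ Λ ↔ intVec a ∈ Y := fun a => Iff.rfl
  refine mem_affineSpan_inter_of_integral (affineSpan ℝ K) Λ (fun k a hk h => ?_) (fun a ha => ?_)
    fun y hy => ?_
  · rw [hΛ, intVec_zsmul] at h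
    exact (Y.smul_mem_iff (Int.cast_ne_zero.2 hk)).1 h
  · have h1 := mem_span_intNear W hδ hstable ((hΛ a).1 ha)
    rw [hS₂span] at h1
    clear ha
    induction h1 using Submodule.span_induction with
    | mem a ha => exact hint a ha
    | zero => exact ⟨0, by simp [inner_intVec]⟩
    | add a b _ _ iha ihb =>
      obtain ⟨k, hk⟩ := iha
      obtain ⟨l, hl⟩ := ihb
      exact ⟨k + l, by rw [intVec_add, inner_add_left, hk, hl, Int.cast_add]⟩
    | smul c a _ iha =>
      obtain ⟨k, hk⟩ := iha
      exact ⟨c * k, by rw [intVec_zsmul, real_inner_smul_left, hk, Int.cast_mul]⟩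
  · have h1 : Y ≤ (ℝ ∙ (y - x))ᗮ := by
      refine Submodule.span_le.2 ?_
      rintro _ ⟨a, ha, rfl⟩
      refine Submodule.mem_orthogonal_singleton_iff_inner_left.2 ?_
      rw [inner_sub_right, hy a (Submodule.subset_span ⟨a, ha, rfl⟩), sub_self]
    have h2 : y - x ∈ (affineSpan ℝ K).direction := by
      rw [← Submodule.orthogonal_orthogonal (affineSpan ℝ K).direction, Submodule.mem_orthogonal]
      exact fun w hw => Submodule.mem_orthogonal_singleton_iff_inner_left.1
        (h1 (le_span_intNear W hδ hw))
    simpa using AffineSubspace.vadd_mem_of_mem_direction h2 hxA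

/-! ### Compactness over directions -/

/-- A functional constant on K is orthogonal to the direction space of aff(K). Only directions
inside that space are used, so the hypothesis on proper faces applies. -/
theorem exposedFace_ne_self {K : Set (𝔼 n)} {v p : 𝔼 n} (hp : p ∈ K)
    (hmax : ∀ y ∈ K, ⟪v, y⟫ ≤ ⟪v, p⟫) (hv : v ∈ (affineSpan ℝ K).direction) (hv0 : v ≠ 0) :
    exposedFace K v ≠ K := by
  intro h
  have h1 : ∀ y ∈ K, ⟪v, y⟫ = ⟪v, p⟫ := fun y hy =>
    (mem_supportHyperplane_iff hp hmax).1 (h.symm.subset hy).2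
  have h2 : (affineSpan ℝ K).direction ≤ (ℝ ∙ v)ᗮ := by
    rw [direction_affineSpan, vectorSpan_def, Submodule.span_le]
    rintro _ ⟨y, hy, z, hz, rfl⟩
    refine Submodule.mem_orthogonal_singleton_iff_inner_right.2 ?_
    simp only [vsub_eq_sub]
    rw [inner_sub_right, h1 y hy, h1 z hz, sub_self]
  have h3 := Submodule.mem_orthogonal_singleton_iff_inner_right.1 (h2 hv)
  exact hv0 (inner_self_eq_zero.1 h3)

/-- For a compact convex set all of whose proper exposed faces have a finitely generated closure,
finitely many cuts confine the closure to the set and its integral affine hull, and determine it on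
the relative boundary. -/
theorem exists_finite_cgClosureWith_inter_intrinsicFrontier {K : Set (𝔼 n)} (hcompact : IsCompact K)
    (hconvex : Convex ℝ K) (hfaces : ∀ v ∈ Metric.sphere (0 : 𝔼 n) 1,
      exposedFace K v ≠ K → FinitelyGenerated (exposedFace K v)) :
    ∃ S : Set (Fin n → ℤ), S.Finite ∧ cgClosureWith K S ⊆ K ∩ (affI K : Set (𝔼 n)) ∧
      cgClosureWith K S ∩ intrinsicFrontier ℝ K = cgClosure K ∩ intrinsicFrontier ℝ K := by
  rcases K.eq_empty_or_nonempty with rfl | hne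
  -- For empty K the cut of the zero vector reads 0 ≤ -∞.
  · refine ⟨{0}, Set.finite_singleton _, fun x hx => ?_, by simp⟩
    simp [cgClosureWith, supportFun, erealFloor] at hx
  let Z : Set (EuclideanSpace ℝ (Fin n)) :=
    Metric.sphere 0 1 ∩ ((affineSpan ℝ K).direction : Set (EuclideanSpace ℝ (Fin n)))
  have hZ : IsCompact Z :=
    (isCompact_sphere _ _).inter_right (Submodule.closed_of_finiteDimensional _)
  obtain ⟨S₁, hS₁, hcov⟩ : ∃ S : Set (Fin n → ℤ), S.Finite ∧
      ∀ u ∈ Z, ∀ q ∈ K, (∀ y ∈ K, ⟪u, y⟫ ≤ ⟪u, q⟫) →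
        ∀ x ∈ cgClosureWith K S, ⟪u, x⟫ ≤ ⟪u, q⟫ ∧ (⟪u, x⟫ = ⟪u, q⟫ → x ∈ cgClosure K) := by
    refine hZ.induction_on (p := fun Z => ∃ S : Set (Fin n → ℤ), S.Finite ∧
      ∀ u ∈ Z, ∀ q ∈ K, (∀ y ∈ K, ⟪u, y⟫ ≤ ⟪u, q⟫) →
        ∀ x ∈ cgClosureWith K S, ⟪u, x⟫ ≤ ⟪u, q⟫ ∧ (⟪u, x⟫ = ⟪u, q⟫ → x ∈ cgClosure K))
      ⟨∅, Set.finite_empty, by simp⟩ ?_ ?_ ?_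
    · rintro s t hst ⟨S, hS, h⟩
      exact ⟨S, hS, fun u hu => h u (hst hu)⟩
    · rintro s t ⟨S, hS, h⟩ ⟨S', hS', h'⟩
      refine ⟨S ∪ S', hS.union hS', fun u hu q hq hmax x hx => ?_⟩
      rcases hu with hu | hu
      · exact h u hu q hq hmax x (cgClosureWith_anti Set.subset_union_left hx)
      · exact h' u hu q hq hmax x (cgClosureWith_anti Set.subset_union_right hx)
    · intro v hv
      obtain ⟨p, hp, hmax⟩ := exists_forall_inner_le hcompact hne v
      have hv0 : v ≠ 0 := ne_zero_of_mem_unit_sphere ⟨v, hv.1⟩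
      obtain ⟨S, hS, hev⟩ := exists_finite_eventually hcompact hconvex hne
        (hfaces v hv.1 (exposedFace_ne_self hp hmax hv.2 hv0))
      exact ⟨_, nhdsWithin_le_nhds hev, S, hS, fun u hu => hu⟩
  obtain ⟨S₀, hS₀, haff⟩ := exists_finite_subset_affI hcompact hne
  refine ⟨S₀ ∪ S₁, hS₀.union hS₁, fun x hx => ?_, ?_⟩
  · have hxI := haff (cgClosureWith_anti Set.subset_union_left hx)
    refine ⟨?_, hxI⟩
    -- Membership in the affine hull puts the normal separating x from K into the compact set `Z`.
    have hxA : x ∈ affineSpan ℝ K := affineSpan_le.2 Set.inter_subset_left hxI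
    obtain ⟨p, hp, -, hmax⟩ := exists_nearest_point hcompact hconvex hne x
    by_contra hxK
    have hxp : x - p ≠ 0 := fun h => hxK (sub_eq_zero.1 h ▸ hp)
    have hpos : 0 < ‖x - p‖⁻¹ := inv_pos.2 (norm_pos_iff.2 hxp)
    have hu : ‖x - p‖⁻¹ • (x - p) ∈ Z := by
      refine ⟨?_, Submodule.smul_mem _ _
        (AffineSubspace.vsub_mem_direction hxA (subset_affineSpan ℝ K hp))⟩
      simp [norm_smul, inv_mul_cancel₀ (norm_ne_zero_iff.2 hxp)]
    have h1 := (hcov _ hu p hp (fun y hy => by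
      rw [real_inner_smul_left, real_inner_smul_left]
      exact mul_le_mul_of_nonneg_left (hmax y hy) hpos.le) x
      (cgClosureWith_anti Set.subset_union_right hx)).1
    rw [real_inner_smul_left, real_inner_smul_left, mul_le_mul_iff_of_pos_left hpos, ← sub_nonpos,
      ← inner_sub_right, real_inner_self_nonpos] at h1
    exact hxp h1
  · refine Set.Subset.antisymm (fun x hx => ⟨?_, hx.2⟩)
      (Set.inter_subset_inter_left _ (cgClosure_subset _))
    obtain ⟨u, hu, hu1, hxK, hmax⟩ :=
      exists_unit_support_of_mem_intrinsicFrontier hcompact hconvex hx.2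
    exact (hcov u ⟨by simpa using hu1, hu⟩ x hxK hmax x
      (cgClosureWith_anti Set.subset_union_right hx.1)).2 rfl

end CGClosure

theorem mainTheorem7 (n : ℕ) (K : Set (EuclideanSpace ℝ (Fin n)))
    (hcompact : IsCompact K) (hconvex : Convex ℝ K)
    (hfaces : ∀ v ∈ Metric.sphere (0 : EuclideanSpace ℝ (Fin n)) 1,
      CGClosure.exposedFace K v ≠ K →
        CGClosure.FinitelyGenerated (CGClosure.exposedFace K v)) :
    ∃ S : Set (Fin n → ℤ), S.Finite ∧
      CGClosure.cgClosureWith K S ⊆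
        K ∩ (CGClosure.affI K : Set (EuclideanSpace ℝ (Fin n))) ∧
      CGClosure.cgClosureWith K S ∩ intrinsicFrontier ℝ K =
        CGClosure.cgClosure K ∩ intrinsicFrontier ℝ K :=
  CGClosure.exists_finite_cgClosureWith_inter_intrinsicFrontier hcompact hconvex hfaces
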